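/- Let $L$ be a first-order language, $M$ a nonempty $L$-structure and $A\subseteq M$. For an integer $n\ge 1$ let $\mathrm{acl}_n(A)$ be the set of all $b\in M$ that satisfy some $L$-formula $\varphi(x,\bar a)$ with parameters $\bar a$ from $A$ having at most $n$ solutions in $M$, and let $\mathrm{acl}(A)=\bigcup_{n\ge 1}\mathrm{acl}_n(A)$. The degree of algebraization $\deg_{\mathrm{acl}}(A)$ over $A$ is the least $n\ge 1$ with $\mathrm{acl}(A)=\mathrm{acl}_n(A)$, and $\infty$ if there is no such $n$. For a consistent first-order theory $T$, the degree of algebraization $\deg_{\mathrm{acl}}(T)$ is the supremum of $\deg_{\mathrm{acl}}(A)$ over all subsets $A$ of models of $T$; it is taken in the class of ordinals with an additional greatest element $\infty$ (so a supremum of finite degrees that are unbounded is the ordinal $\omega$, while it is $\infty$ if some $A$ has degree $\infty$). 1. For every consistent theory $T$, $\deg_{\mathrm{acl}}(T)\in((\omega+1)\setminus\{0\})\cup\{\infty\}$. 2. For every $\lambda\in((\omega+1)\setminus\{0\})\cup\{\infty\}$ there is a complete theory $T_\lambda$ with $\deg_{\mathrm{acl}}(T_\lambda)=\lambda$. Moreover,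 for $\lambda\ne\omega$ one can take $T_\lambda=\mathrm{Th}(M)$ for a set $M$ with an equivalence relation $E$, in the language $\{E\}$; and for $\lambda=\omega$ one can take $T_\omega=\mathrm{Th}(M')$ where $M'$ is an expansion, by countably many ternary predicates, of a set with an equivalence relation all of whose classes are finite and which has infinitely many $n$-element classes for each $n\ge 1$. -/

import Mathlib

open FirstOrder

universe u v w

namespace Algebraization

/-- The algebraic closure of `A` in the structure `M`: the union of all finite subsets of `M`
that are definable with parameters from `A`. -/
def acl (L : FirstOrder.Language.{u, v}) {M : Type w} [L.Structure M] (A : Set M) : Set M :=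
  {b | ∃ S : Set M, A.Definable₁ L S ∧ S.Finite ∧ b ∈ S}

/-- The set of `n`-algebraic elements over `A`: the union of all subsets of `M` with at most `n`
elements that are definable with parameters from `A`. -/
def aclN (L : FirstOrder.Language.{u, v}) {M : Type w} [L.Structure M] (n : ℕ) (A : Set M) : Set M :=
  {b | ∃ S : Set M, A.Definable₁ L S ∧ S.Finite ∧ S.ncard ≤ n ∧ b ∈ S}

open Classical in
/-- The degree of algebraization over the set `A`: the least `n ≥ 1` such that every element
algebraic over `A` is `n`-algebraic over `A`, and `∞ = ⊤` if there is no such `n`.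
The values lie in the ordinals with a greatest element `∞` added on top, so that the ordinal
`ω` and `∞` are different. -/
noncomputable def degAclSet (L : FirstOrder.Language.{u, v}) {M : Type w} [L.Structure M] (A : Set M) :
    WithTop Ordinal.{0} :=
  if h : ∃ n : ℕ, 1 ≤ n ∧ acl L A = aclN L n A then (((Nat.find h : ℕ) : Ordinal.{0}) :
    WithTop Ordinal.{0}) else ⊤

/-- The degree of algebraization of a theory: the supremum of the degrees over all sets `A` of
elements of models of `T`. -/
noncomputable def degAcl {L : FirstOrder.Language.{u, v}} (T : L.Theory) : WithTop Ordinal.{0} :=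
  sSup {d | ∃ (M : FirstOrder.Language.Theory.ModelType.{u, v, max u v} T) (A : Set M),
    d = degAclSet L A}

/-- The set `((ω + 1) ∖ {0}) ∪ {∞}`, where the ordinal `ω + 1` is the set of ordinals
smaller than it. -/
def degValues : Set (WithTop Ordinal.{0}) :=
  ((fun a : Ordinal.{0} => (a : WithTop Ordinal.{0})) ''
    (Set.Iio (Ordinal.omega0 + 1) \ {0})) ∪ {⊤}

/-- The only symbol of the language `{E}`. -/
inductive EqvRel : ℕ → Type
  | E : EqvRel 2

/-- The language `{E}` with one binary relation symbol. -/
def eqvLang : FirstOrder.Language.{0, 0} := ⟨fun _ => Empty, EqvRel⟩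

/-- Countably many ternary relation symbols. -/
inductive TernRel : ℕ → Type
  | R (i : ℕ) : TernRel 3

/-- The language of countably many ternary relation symbols. -/
def ternLang : FirstOrder.Language.{0, 0} := ⟨fun _ => Empty, TernRel⟩

/-- The interpretation of `E` in an `{E}`-structure. -/
def interpE (M : Type w) [eqvLang.Structure M] (a b : M) : Prop :=
  FirstOrder.Language.Structure.RelMap (L := eqvLang) (M := M) EqvRel.E ![a, b]

/-- All `E`-classes of `M` are finite, and for every `n ≥ 1` there are infinitely many with
exactly `n` elements. -/
def InfManyClassesOfEachFiniteSize (M : Type w) [eqvLang.Structure M] : Prop :=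
  (∀ a : M, {b | interpE M a b}.Finite) ∧
    ∀ n : ℕ, 1 ≤ n →
      {X : Set M | (∃ a : M, X = {b | interpE M a b}) ∧ X.ncard = n}.Infinite

end Algebraization

open Algebraization

namespace Algebraization

open FirstOrder.Language Set

/-! ### Degrees, their possible suprema, and definability with parameters. -/

section Degree

variable {L : FirstOrder.Language.{u, v}} {M : Type w} [L.Structure M] {A : Set M}

/-! If no degree is `∞`, all are positive integers and their supremum lies between `1` and `ω`. For
the examples, lower bounds come from automorphisms fixing the parameters, and upper bounds must hold
in every model, so they are phrased by first-order sentences.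

A finite `n` comes from one class of size `n` beside an infinite class: an algebraic element outside
`A` has a finite class (`finite_class_of_mem_acl`), hence lies in the class of size at most `n`. The
value `∞` comes from finite classes of unbounded size, with one parameter chosen in each.

For `ω` the degree over each single set must be finite, but without a common bound. In `CyclePoint`
each class is a cycle plus one unmarked point. A parameter `a` orders all points outside its class,
and all points whatsoever if `a` is marked; a definable order makes every element of a finite
definable set definable (`definable₁_singleton_of_mem_of_isStrictOrder`). Two distinct unmarked
parameters lie in different classes and order each other's class. So the degree is `1` except
possibly over a single unmarked point, whose cycle remains indiscernible and can have any length.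
Over `∅` nothing is algebraic. These properties are first-order schemes (`TotalOffClasses`) and pass
to all models; in `CyclePoint` they follow from the automorphisms `rotateAut`. -/

theorem aclN_subset_acl (n : ℕ) : aclN L n A ⊆ acl L A := by
  rintro b ⟨S, hS, hfin, -, hb⟩
  exact ⟨S, hS, hfin, hb⟩

theorem aclN_mono {m n : ℕ} (h : m ≤ n) : aclN L m A ⊆ aclN L n A := by
  rintro b ⟨S, hS, hfin, hc, hb⟩
  exact ⟨S, hS, hfin, hc.trans h, hb⟩

theorem degAclSet_eq_top_or :
    degAclSet L A = ⊤ ∨ ∃ n : ℕ, 1 ≤ n ∧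
      degAclSet L A = ((n : Ordinal.{0}) : WithTop Ordinal.{0}) := by
  classical
  unfold degAclSet
  split_ifs with h
  · exact Or.inr ⟨_, (Nat.find_spec h).1, rfl⟩
  · exact Or.inl rfl

theorem degAclSet_le {n : ℕ} (h1 : 1 ≤ n) (h : acl L A ⊆ aclN L n A) :
    degAclSet L A ≤ ((n : Ordinal.{0}) : WithTop Ordinal.{0}) := by
  classical
  have hex : ∃ n : ℕ, 1 ≤ n ∧ acl L A = aclN L n A := ⟨n, h1, h.antisymm (aclN_subset_acl n)⟩
  rw [degAclSet, dif_pos hex]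
  exact_mod_cast Nat.find_min' hex ⟨h1, h.antisymm (aclN_subset_acl n)⟩

theorem le_degAclSet {n : ℕ} {b : M} (hb : b ∈ acl L A)
    (h : ∀ S : Set M, A.Definable₁ L S → S.Finite → b ∈ S → n ≤ S.ncard) :
    ((n : Ordinal.{0}) : WithTop Ordinal.{0}) ≤ degAclSet L A := by
  classical
  unfold degAclSet
  split_ifs with hex
  · obtain ⟨-, hm⟩ := Nat.find_spec hex
    rw [hm] at hb
    obtain ⟨S, hS, hfin, hc, hbS⟩ := hb
    exact_mod_cast (h S hS hfin hbS).trans hc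
  · exact le_top

theorem isLUB_degAcl (T : L.Theory) :
    IsLUB {d | ∃ (M : FirstOrder.Language.Theory.ModelType.{u, v, max u v} T) (A : Set M),
      d = degAclSet L A} (degAcl T) :=
  WithTop.isLUB_sSup _

theorem degAclSet_le_degAcl (T : L.Theory) (M : Theory.ModelType.{u, v, max u v} T) (A : Set M) :
    degAclSet L A ≤ degAcl T :=
  (isLUB_degAcl T).1 ⟨M, A, rfl⟩

theorem degAcl_le {T : L.Theory} {d : WithTop Ordinal.{0}}
    (h : ∀ (M : Theory.ModelType.{u, v, max u v} T) (A : Set M), degAclSet L A ≤ d) :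
    degAcl T ≤ d :=
  (isLUB_degAcl T).2 (by rintro _ ⟨M, A, rfl⟩; exact h M A)

theorem natCast_le_omega0_withTop (n : ℕ) :
    ((n : Ordinal.{0}) : WithTop Ordinal.{0}) ≤ (Ordinal.omega0 : Ordinal.{0}) :=
  WithTop.coe_le_coe.2 (Ordinal.natCast_lt_omega0 n).le

theorem degAcl_le_omega0 {T : L.Theory}
    (h : ∀ (M : Theory.ModelType.{u, v, max u v} T) (A : Set M),
      ∃ n : ℕ, 1 ≤ n ∧ acl L A ⊆ aclN L n A) :
    degAcl T ≤ (Ordinal.omega0 : Ordinal.{0}) :=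
  degAcl_le fun M A => by
    obtain ⟨n, h1, hn⟩ := h M A
    exact (degAclSet_le h1 hn).trans (natCast_le_omega0_withTop n)

theorem omega0_le_of_natCast_le {d : WithTop Ordinal.{0}}
    (h : ∀ n : ℕ, ((n : Ordinal.{0}) : WithTop Ordinal.{0}) ≤ d) :
    ((Ordinal.omega0 : Ordinal.{0}) : WithTop Ordinal.{0}) ≤ d := by
  induction d with
  | top => exact le_top
  | coe a =>
    exact WithTop.coe_le_coe.2 (Ordinal.omega0_le.2 fun n => WithTop.coe_le_coe.1 (h n))

theorem degAcl_mem_degValues {T : L.Theory} (hT : T.IsSatisfiable) : degAcl T ∈ degValues := by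
  by_cases htop : degAcl T = ⊤
  · exact Or.inr htop
  left
  have hle : degAcl T ≤ (Ordinal.omega0 : Ordinal.{0}) := degAcl_le fun M A => by
    rcases degAclSet_eq_top_or (L := L) (A := A) with h | ⟨n, -, h⟩
    · exact absurd (top_le_iff.1 (h ▸ degAclSet_le_degAcl T M A)) htop
    · exact h ▸ natCast_le_omega0_withTop n
  have hge : ((1 : ℕ) : Ordinal.{0}) ≤ degAcl T := by
    obtain ⟨M⟩ := hT
    refine le_trans ?_ (degAclSet_le_degAcl T M ∅)
    rcases degAclSet_eq_top_or (L := L) (A := (∅ : Set M)) with h | ⟨n, hn, h⟩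
    · exact h ▸ le_top
    · rw [h]
      exact_mod_cast hn
  obtain ⟨a, ha⟩ := WithTop.ne_top_iff_exists.1 htop
  rw [← ha] at hle hge
  refine ⟨a, ⟨Order.lt_add_one_iff.2 (WithTop.coe_le_coe.1 hle), ?_⟩, ha⟩
  rintro rfl
  exact absurd (WithTop.coe_le_coe.1 hge) (by simp)

theorem mem_degValues_cases {d : WithTop Ordinal.{0}} (hd : d ∈ degValues) :
    (∃ n : ℕ, 1 ≤ n ∧ d = ((n : Ordinal.{0}) : WithTop Ordinal.{0})) ∨
      d = ((Ordinal.omega0 : Ordinal.{0}) : WithTop Ordinal.{0}) ∨ d = ⊤ := by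
  rcases hd with ⟨a, ⟨ha, h0⟩, rfl⟩ | rfl
  · rcases (Order.lt_add_one_iff.1 (mem_Iio.1 ha)).lt_or_eq with h | rfl
    · obtain ⟨n, rfl⟩ := Ordinal.lt_omega0.1 h
      refine Or.inl ⟨n, Nat.one_le_iff_ne_zero.2 ?_, rfl⟩
      rintro rfl
      exact h0 (by simp)
    · exact Or.inr (Or.inl rfl)
  · exact Or.inr (Or.inr rfl)

theorem mem_iff_of_definable₁_of_equiv (e : M ≃[L] M) (he : ∀ a ∈ A, e a = a) {S : Set M}
    (hS : A.Definable₁ L S) (b : M) : e b ∈ S ↔ b ∈ S := by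
  obtain ⟨φ, hφ⟩ := definable_iff_exists_formula_sum.1 hS
  have key (x : M) : x ∈ S ↔ φ.Realize (Sum.elim (↑) fun _ : Fin 1 => x : A ⊕ Fin 1 → M) := by
    have := Set.ext_iff.1 hφ fun _ => x
    exact this
  rw [key, key b, ← StrongHomClass.realize_formula e φ (v := Sum.elim (↑) fun _ => b)]
  refine iff_of_eq (congrArg _ (funext ?_))
  rintro (a | i)
  · exact (he a a.2).symm
  · rfl

theorem definable_of_formula {α β : Type*} (φ : L.Formula (β ⊕ α)) (a : β → M)
    (ha : ∀ i, a i ∈ A) : A.Definable L {v | φ.Realize (Sum.elim a v)} := by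
  refine definable_iff_exists_formula_sum.2
    ⟨φ.relabel (Sum.map (fun i => (⟨a i, ha i⟩ : A)) id), ?_⟩
  ext v
  simp only [mem_ofPred_eq, Formula.realize_relabel]
  refine iff_of_eq (congrArg _ (funext ?_))
  rintro (i | i) <;> rfl

theorem definable₁_of_formula {β : Type*} (φ : L.Formula (β ⊕ Fin 1)) (a : β → M)
    (ha : ∀ i, a i ∈ A) :
    A.Definable₁ L {x | φ.Realize (Sum.elim a fun _ => x)} := by
  unfold Definable₁
  convert definable_of_formula φ a ha using 1
  ext x
  have hx : (fun _ => x 0) = x := funext fun i => by rw [Subsingleton.elim i 0]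
  simp only [mem_ofPred_eq, hx]

theorem definable₁_setOf_realize (φ : L.Formula (Fin 1)) :
    A.Definable₁ L {x | φ.Realize fun _ => x} := by
  simpa [Formula.realize_relabel, Function.comp_def] using
    definable₁_of_formula (A := A) (φ.relabel (Sum.inr : Fin 1 → Empty ⊕ Fin 1)) Empty.elim
      fun i => i.elim

end Degree

/-! ### Transfer of universal statements and of cardinality bounds between models. -/

section Transfer

/-- Finiteness alone is not first-order, but together with a fixed bound it is. It must be stated
separately, as `ncard` is `0` on infinite sets. -/
theorem finite_and_ncard_lt_iff {α : Type*} {S : Set α} {k : ℕ} :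
    S.Finite ∧ S.ncard < k ↔ ∀ v : Fin k → α, (∀ i, v i ∈ S) → ¬ Function.Injective v := by
  constructor
  · rintro ⟨hfin, hk⟩ v hv hinj
    have := ncard_le_ncard (range_subset_iff.2 hv) hfin
    rw [← Nat.card_coe_set_eq, Nat.card_range_of_injective hinj, Nat.card_fin] at this
    exact absurd hk this.not_gt
  · intro h
    by_contra hS
    have hex : ∃ t : Finset α, ↑t ⊆ S ∧ t.card = k := by
      by_cases hfin : S.Finite
      · obtain ⟨t, rfl⟩ := hfin.exists_finset_coe
        rw [ncard_coe_finset, not_and, not_lt] at hS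
        obtain ⟨t', h1, h2⟩ := Finset.exists_subset_card_eq (hS hfin)
        exact ⟨t', Finset.coe_subset.2 h1, h2⟩
      · exact Set.Infinite.exists_subset_card_eq hfin k
    obtain ⟨t, hts, rfl⟩ := hex
    exact h (fun i => t.equivFin.symm i) (fun i => hts (t.equivFin.symm i).2)
      (Subtype.val_injective.comp t.equivFin.symm.injective)

variable {L : FirstOrder.Language.{u, v}} {M : Type*} [L.Structure M] {N : Type*} [L.Structure N]

theorem forall_realize_iff_of_model_completeTheory [N ⊨ L.completeTheory M] {k : ℕ}
    (φ : L.Formula (Fin k)) :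
    (∀ v : Fin k → N, φ.Realize v) ↔ ∀ v : Fin k → M, φ.Realize v := by
  have := realize_iff_of_model_completeTheory M N
    (Formula.iAlls (Fin k) (φ.relabel (Sum.inr : Fin k → Empty ⊕ Fin k)))
  simpa [Sentence.Realize, Formula.realize_iAlls, Formula.realize_relabel, Function.comp_def]
    using this

/-- The formula stating that the given variables do not take distinct values. -/
noncomputable def notInjective {α : Type*} {k : ℕ} (f : Fin k → α) : L.Formula α :=
  Formula.iSup fun p : {p : Fin k × Fin k // p.1 ≠ p.2} =>
    Term.equal (Term.var (f p.1.1)) (Term.var (f p.1.2))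

theorem realize_notInjective {α : Type*} {k : ℕ} {f : Fin k → α} {v : α → M} :
    (notInjective (L := L) f).Realize v ↔ ¬ Function.Injective (v ∘ f) := by
  simp only [notInjective, Formula.realize_iSup, Formula.realize_equal, Term.realize_var,
    Function.Injective, Function.comp_apply]
  push Not
  exact ⟨fun ⟨p, h⟩ => ⟨_, _, h, p.2⟩, fun ⟨i, j, h, hne⟩ => ⟨⟨(i, j), hne⟩, h⟩⟩

/-- The formula stating that its `k` variables are not distinct solutions of `φ`. -/
noncomputable def notDistinctSolutions (φ : L.Formula (Fin 1)) (k : ℕ) : L.Formula (Fin k) :=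
  (Formula.iInf fun i : Fin k => φ.relabel fun _ => i).imp (notInjective id)

theorem forall_realize_notDistinctSolutions {φ : L.Formula (Fin 1)} {k : ℕ} :
    (∀ v : Fin k → M, (notDistinctSolutions φ k).Realize v) ↔
      {x : M | φ.Realize fun _ => x}.Finite ∧ {x : M | φ.Realize fun _ => x}.ncard < k := by
  simp only [finite_and_ncard_lt_iff, notDistinctSolutions, Formula.realize_imp,
    Formula.realize_iInf, realize_notInjective, Formula.realize_relabel]
  exact Iff.rfl

theorem finite_ncard_lt_iff_of_model_completeTheory [N ⊨ L.completeTheory M]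
    (φ : L.Formula (Fin 1)) (k : ℕ) :
    {x : N | φ.Realize fun _ => x}.Finite ∧ {x : N | φ.Realize fun _ => x}.ncard < k ↔
      {x : M | φ.Realize fun _ => x}.Finite ∧ {x : M | φ.Realize fun _ => x}.ncard < k := by
  rw [← forall_realize_notDistinctSolutions, ← forall_realize_notDistinctSolutions]
  exact forall_realize_iff_of_model_completeTheory _

end Transfer

/-! ### Equivalence relations: finite degrees and `∞`. -/

section EquivalenceRelation

variable {M : Type w} [eqvLang.Structure M]

/-- Transposing two equivalent elements is an automorphism of an equivalence relation. -/
def swapEquiv [DecidableEq M] (hE : Equivalence (interpE M)) {x y : M} (hxy : interpE M x y) :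
    M ≃[eqvLang] M where
  toEquiv := Equiv.swap x y
  map_fun' := fun f => f.elim
  map_rel' := by
    rintro _ ⟨⟩ v
    have hs (z : M) : interpE M z (Equiv.swap x y z) := by
      by_cases h1 : z = x
      · subst h1; simpa using hxy
      by_cases h2 : z = y
      · subst h2; simpa using hE.symm hxy
      rw [Equiv.swap_apply_of_ne_of_ne h1 h2]
      exact hE.refl z
    have hv (v : Fin 2 → M) : Structure.RelMap (L := eqvLang) EqvRel.E v ↔ interpE M (v 0) (v 1) := by
      unfold interpE
      refine iff_of_eq (congrArg _ (funext fun i => ?_))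
      fin_cases i <;> rfl
    rw [hv, hv]
    exact ⟨fun h => hE.trans (hs _) (hE.trans h (hE.symm (hs _))),
      fun h => hE.trans (hE.symm (hs _)) (hE.trans h (hs _))⟩

theorem mem_of_definable₁_of_interpE (hE : Equivalence (interpE M)) {A S : Set M} {x y : M}
    (hxy : interpE M x y) (hx : x ∉ A) (hy : y ∉ A) (hS : A.Definable₁ eqvLang S) (hxS : x ∈ S) :
    y ∈ S := by
  classical
  have := mem_iff_of_definable₁_of_equiv (swapEquiv hE hxy)
    (fun a ha => Equiv.swap_apply_of_ne_of_ne (fun h => hx (h ▸ ha)) fun h => hy (h ▸ ha)) hS x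
  have hxy' : swapEquiv hE hxy x = y := Equiv.swap_apply_left x y
  rw [hxy'] at this
  exact this.2 hxS

/-- The formula `E(i, j)` in the language `{E}`. -/
def interpEFormula {α : Type*} (i j : α) : eqvLang.Formula α :=
  Relations.formula (show eqvLang.Relations 2 from EqvRel.E) ![Term.var i, Term.var j]

@[simp]
theorem realize_interpEFormula {α : Type*} {i j : α} {v : α → M} :
    (interpEFormula i j).Realize v ↔ interpE M (v i) (v j) := by
  refine Formula.realize_rel.trans (iff_of_eq (congrArg _ (funext fun i => ?_)))
  fin_cases i <;> rfl

theorem definable₁_interpE {A : Set M} {a : M} (ha : a ∈ A) :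
    A.Definable₁ eqvLang {x | interpE M a x} := by
  simpa using definable₁_of_formula (A := A)
    (interpEFormula (Sum.inl ()) (Sum.inr 0)) (fun _ : Unit => a) fun _ => ha

theorem equivalence_interpE_of_model_completeTheory {N : Type*} [eqvLang.Structure N]
    [N ⊨ eqvLang.completeTheory M] (h : Equivalence (interpE M)) : Equivalence (interpE N) := by
  have tr {k : ℕ} (φ : eqvLang.Formula (Fin k)) (hφ : ∀ v : Fin k → M, φ.Realize v) :
      ∀ v : Fin k → N, φ.Realize v := (forall_realize_iff_of_model_completeTheory φ).2 hφ
  refine ⟨fun x => ?_, fun {x y} => ?_, fun {x y z} => ?_⟩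
  · simpa using tr (interpEFormula (0 : Fin 1) 0)
      (fun v : Fin _ → M => by simpa using h.refl (v 0)) ![x]
  · simpa using tr ((interpEFormula (0 : Fin 2) 1).imp (interpEFormula 1 0))
      (fun v : Fin _ → M => by simpa using h.symm) ![x, y]
  · simpa using tr ((interpEFormula (0 : Fin 3) 1).imp
      ((interpEFormula 1 2).imp (interpEFormula 0 2)))
      (fun v : Fin _ → M => by simpa using h.trans) ![x, y, z]

/-- The formula stating that the class of its variable has less than `k` elements. -/
noncomputable def smallClass (k : ℕ) : eqvLang.Formula (Fin 1) :=
  Formula.iAlls (Fin k) ((Formula.iInf fun i : Fin k =>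
    interpEFormula (Sum.inl 0) (Sum.inr i)).imp (notInjective Sum.inr))

theorem realize_smallClass {k : ℕ} {x : M} : ((smallClass k).Realize fun _ => x) ↔
    {y | interpE M x y}.Finite ∧ {y | interpE M x y}.ncard < k := by
  simp only [finite_and_ncard_lt_iff, smallClass, Formula.realize_iAlls, Formula.realize_imp,
    Formula.realize_iInf, realize_notInjective, realize_interpEFormula]
  exact Iff.rfl

/-- An element outside `A` that is algebraic over `A` has a finite class. -/
theorem finite_class_of_mem_acl (hE : Equivalence (interpE M)) {A : Set M} {b : M}
    (hb : b ∈ acl eqvLang A) (hbA : b ∉ A) : {y | interpE M b y}.Finite := by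
  obtain ⟨S, hS, hfin, hbS⟩ := hb
  obtain ⟨A₀, hA₀, hS₀⟩ := definable_iff_finitely_definable.1 hS
  refine (hfin.union A₀.finite_toSet).subset fun y hy => ?_
  by_cases hyA : y ∈ (A₀ : Set M)
  · exact Or.inr hyA
  · exact Or.inl (mem_of_definable₁_of_interpE hE hy (fun h => hbA (hA₀ h)) hyA hS₀ hbS)

/-- The equivalence relation on `M` with the given setoid as an `{E}`-structure. -/
@[reducible] def eqvStructure {M : Type w} (s : Setoid M) : eqvLang.Structure M where
  funMap := fun f => f.elim
  RelMap := fun {_} r => match r with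
    | EqvRel.E => fun v => s (v 0) (v 1)

theorem exists_degAcl_eq_natCast (n : ℕ) (hn : 1 ≤ n) :
    ∃ (M : Type) (_ : Nonempty M) (_ : eqvLang.Structure M), Equivalence (interpE M) ∧
      degAcl (eqvLang.completeTheory M) = ((n : Ordinal.{0}) : WithTop Ordinal.{0}) := by
  let s : Setoid (Fin n ⊕ ℕ) := Setoid.ker Sum.isLeft
  let _ : eqvLang.Structure (Fin n ⊕ ℕ) := eqvStructure s
  have : Nonempty (Fin n ⊕ ℕ) := ⟨Sum.inr 0⟩
  have hE : Equivalence (interpE (Fin n ⊕ ℕ)) := s.iseqv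
  have hl (i : Fin n) : {y | interpE (Fin n ⊕ ℕ) (Sum.inl i) y} = range Sum.inl := by
    ext (j | j)
    · exact iff_of_true rfl ⟨j, rfl⟩
    · exact iff_of_false (by rintro ⟨⟩) (by simp)
  have hr (i : ℕ) : {y | interpE (Fin n ⊕ ℕ) (Sum.inr i) y}.Infinite :=
    infinite_of_injective_forall_mem (f := (Sum.inr : ℕ → Fin n ⊕ ℕ)) Sum.inr_injective fun _ => rfl
  have hcard : (range (Sum.inl : Fin n → Fin n ⊕ ℕ)).ncard = n := by
    rw [← Nat.card_coe_set_eq, Nat.card_range_of_injective Sum.inl_injective, Nat.card_fin]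
  have hsmall : {x : Fin n ⊕ ℕ | (smallClass (n + 1)).Realize fun _ => x} = range Sum.inl := by
    ext (i | i)
    · exact iff_of_true (realize_smallClass.2 (by
        rw [hl, hcard]
        exact ⟨finite_range _, Nat.lt_succ_self n⟩)) ⟨i, rfl⟩
    · exact iff_of_false (fun h => hr i (realize_smallClass.1 h).1) (by simp)
  refine ⟨Fin n ⊕ ℕ, inferInstance, inferInstance, hE, le_antisymm ?_ ?_⟩
  · refine degAcl_le fun N A => degAclSet_le hn fun b hb => ?_
    by_cases hbA : b ∈ A
    · exact ⟨{b}, Definable.singleton_of_mem _ hbA, finite_singleton b, by simpa using hn, rfl⟩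
    have hfin := finite_class_of_mem_acl
      (equivalence_interpE_of_model_completeTheory (N := N) hE) hb hbA
    have hN := (finite_ncard_lt_iff_of_model_completeTheory (M := Fin n ⊕ ℕ) (N := N)
      (smallClass (n + 1)) (n + 1)).2 (by
        rw [hsmall, hcard]
        exact ⟨finite_range _, Nat.lt_succ_self n⟩)
    refine ⟨_, definable₁_setOf_realize (smallClass (n + 1)), hN.1, Nat.lt_succ_iff.1 hN.2, ?_⟩
    -- Finiteness of the class of `b` becomes first-order once its size `k` is fixed; the
    -- implication transferred next is true in the original structure because its only finite class
    -- has `n` elements.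
    set k := {y | interpE N b y}.ncard
    have := (forall_realize_iff_of_model_completeTheory (M := Fin n ⊕ ℕ) (N := N)
      ((smallClass (k + 1)).imp (smallClass (n + 1)))).2 fun v => by
        rw [show v = fun _ => v 0 from funext fun i => by rw [Subsingleton.elim i 0] ]
        refine Formula.realize_imp.2 fun hv => ?_
        rcases hv0 : v 0 with i | i
        · exact hsmall.ge ⟨i, rfl⟩
        · rw [hv0] at hv
          exact absurd (realize_smallClass.1 hv).1 (hr i)
    exact Formula.realize_imp.1 (this fun _ => b) (realize_smallClass.2 ⟨hfin, Nat.lt_succ_self k⟩)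
  · refine le_trans ?_ (degAclSet_le_degAcl _ (Theory.ModelType.of _ (Fin n ⊕ ℕ)) ∅)
    have hdef : (∅ : Set (Fin n ⊕ ℕ)).Definable₁ eqvLang (range Sum.inl) :=
      hsmall ▸ definable₁_setOf_realize (smallClass (n + 1))
    refine le_degAclSet (L := eqvLang) (M := Fin n ⊕ ℕ) (b := Sum.inl ⟨0, hn⟩)
      ⟨range Sum.inl, hdef, finite_range _, ⟨_, rfl⟩⟩ fun S hS hfin hb => ?_
    have hsub : range Sum.inl ⊆ S := by
      rintro _ ⟨i, rfl⟩
      exact mem_of_definable₁_of_interpE hE (x := Sum.inl ⟨0, hn⟩) rfl (notMem_empty _) (notMem_empty _) hS hb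
    exact hcard.symm.trans_le (ncard_le_ncard hsub hfin)

theorem exists_degAcl_eq_top :
    ∃ (M : Type) (_ : Nonempty M) (_ : eqvLang.Structure M), Equivalence (interpE M) ∧
      degAcl (eqvLang.completeTheory M) = ⊤ := by
  -- With sizes `n + 2`, each class keeps `n + 1 ≥ 1` interchangeable elements after one is put into
  -- `A`.
  let s : Setoid (Σ n : ℕ, Fin (n + 2)) := Setoid.ker Sigma.fst
  let _ : eqvLang.Structure (Σ n : ℕ, Fin (n + 2)) := eqvStructure s
  have hEq : Equivalence (interpE (Σ n : ℕ, Fin (n + 2))) := s.iseqv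
  refine ⟨_, ⟨⟨0, 0⟩⟩, inferInstance, hEq, top_le_iff.1 ?_⟩
  let A : Set (Σ n : ℕ, Fin (n + 2)) := {x | x.2 = 0}
  have : Nonempty (Σ n : ℕ, Fin (n + 2)) := ⟨⟨0, 0⟩⟩
  refine le_trans ?_ (degAclSet_le_degAcl _ (Theory.ModelType.of _ (Σ n : ℕ, Fin (n + 2))) A)
  have key (n : ℕ) : ((n + 1 : ℕ) : Ordinal.{0}) ≤ degAclSet eqvLang A := by
    have hfin : (range fun j : Fin (n + 2) => (⟨n, j⟩ : Σ n : ℕ, Fin (n + 2))).Finite := finite_range _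
    refine le_degAclSet (b := ⟨n, 1⟩) ⟨{x | interpE (Σ n : ℕ, Fin (n + 2)) ⟨n, 0⟩ x},
      definable₁_interpE (show (⟨n, 0⟩ : Σ n : ℕ, Fin (n + 2)) ∈ A from rfl),
      hfin.subset ?_, (rfl : n = n)⟩ fun S hS hSfin hb => ?_
    · rintro ⟨m, j⟩ (rfl : n = m)
      exact ⟨j, rfl⟩
    · have hsub : range (fun j : Fin (n + 1) => (⟨n, j.succ⟩ : Σ n : ℕ, Fin (n + 2))) ⊆ S := by
        rintro _ ⟨j, rfl⟩
        exact mem_of_definable₁_of_interpE hEq (x := ⟨n, 1⟩) rfl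
          (fun h : (1 : Fin (n + 2)) = 0 => by simp at h)
          (fun h : j.succ = 0 => absurd h (Fin.succ_ne_zero j)) hS hb
      refine le_trans ?_ (ncard_le_ncard hsub hSfin)
      rw [← Nat.card_coe_set_eq, Nat.card_range_of_injective, Nat.card_fin]
      intro i j h
      simpa using h
  rcases degAclSet_eq_top_or (L := eqvLang) (A := A) with h | ⟨n, -, h⟩
  · exact h.ge
  · have := key n
    rw [h] at this
    exact absurd this (by exact_mod_cast Nat.not_succ_le_self n)

end EquivalenceRelation

/-! ### Definable orders on finite definable sets. -/

section AclBound

variable {L : FirstOrder.Language.{u, v}} {N : Type w} [L.Structure N] {A : Set N}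

theorem exists_formula_of_definable₁_singleton {p : N} {S : Set N}
    (hS : ({p} : Set N).Definable₁ L S) :
    ∃ φ : L.Formula (Fin 2), ∀ x, x ∈ S ↔ φ.Realize ![p, x] := by
  obtain ⟨φ, hφ⟩ := definable_iff_exists_formula_sum.1 hS
  refine ⟨φ.relabel (Sum.elim (fun _ => 0) fun _ => 1), fun x => ?_⟩
  refine (Set.ext_iff.1 hφ fun _ => x).trans ?_
  simp only [mem_ofPred_eq, Formula.realize_relabel]
  refine iff_of_eq (congrArg _ (funext ?_))
  rintro (a | i)
  · exact a.2
  · rfl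

theorem exists_formula_of_definable₁_empty {S : Set N} (hS : (∅ : Set N).Definable₁ L S) :
    ∃ φ : L.Formula (Fin 1), ∀ x, x ∈ S ↔ φ.Realize fun _ => x := by
  obtain ⟨φ, hφ⟩ := empty_definable_iff.1 hS
  exact ⟨φ, fun x => Set.ext_iff.1 hφ fun _ => x⟩

/-- If a definable relation totally orders a finite definable set, then each element of the set
is definable. -/
theorem definable₁_singleton_of_mem_of_isStrictOrder {r : N → N → Prop}
    (hr : A.Definable L {v : Fin 2 → N | r (v 0) (v 1)}) (hirr : ∀ x, ¬ r x x)
    (htrans : ∀ x y z, r x y → r y z → r x z) {S : Set N} (hfin : S.Finite)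
    (hS : A.Definable₁ L S) (htot : ∀ x ∈ S, ∀ y ∈ S, x ≠ y → r x y ∨ r y x) :
    ∀ b ∈ S, A.Definable₁ L {b} := by
  induction hn : S.ncard generalizing S with
  | zero =>
    rw [(ncard_eq_zero hfin).1 hn]
    exact fun b hb => hb.elim
  | succ n ih =>
    have hne : S.Nonempty := nonempty_of_ncard_ne_zero (by omega)
    have : IsStrictOrder N r := { irrefl := hirr, trans := htrans }
    obtain ⟨⟨m, hmS⟩, -, hm⟩ := WellFounded.has_min (hfin.wellFoundedOn (r := r)) univ
      ⟨⟨_, hne.some_mem⟩, trivial⟩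
    have hm' : ∀ y ∈ S, ¬ r y m := fun y hy => hm ⟨y, hy⟩ trivial
    have hmd : A.Definable₁ L {m} := by
      -- The minimal element `m` is the only element of `S` without an `r`-predecessor in `S`; the
      -- elements with one form a projection of a definable set.
      have h0 : A.Definable L {v : Fin 2 → N | v 0 ∈ S} :=
        Definable.preimage_comp (fun _ : Fin 1 => (0 : Fin 2)) hS
      have h1 := (hr.inter h0).image_comp fun _ : Fin 1 => (1 : Fin 2)
      have h2 : A.Definable L ({v : Fin 1 → N | v 0 ∈ S} \ _) := Definable.sdiff hS h1
      unfold Definable₁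
      convert h2 using 1
      ext x
      simp only [mem_singleton_iff, mem_ofPred_eq, mem_sdiff, mem_image, mem_inter_iff, not_exists]
      constructor
      · rintro rfl
        exact ⟨hmS, fun v hv => by
          obtain ⟨⟨hv1, hv2⟩, rfl⟩ := hv
          exact hm' _ hv2 hv1⟩
      · rintro ⟨hx, h⟩
        by_contra hne
        rcases htot _ hx _ hmS hne with h' | h'
        · exact hm' _ hx h'
        · exact h ![m, x 0] ⟨⟨h', hmS⟩, funext fun i => by rw [Subsingleton.elim i 0]; rfl⟩
    have hSm : A.Definable₁ L (S \ {m}) := Definable.sdiff hS hmd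
    intro b hb
    by_cases hbm : b = m
    · exact hbm ▸ hmd
    · refine ih (hfin.subset sdiff_subset) hSm (fun x hx y hy => htot x hx.1 y hy.1) ?_ b ⟨hb, hbm⟩
      rw [ncard_sdiff_singleton_of_mem hmS, hn, Nat.add_sub_cancel]

theorem mem_aclN_one_of_definable₁_singleton {b : N} (h : A.Definable₁ L {b}) : b ∈ aclN L 1 A :=
  ⟨{b}, h, finite_singleton b, (ncard_singleton b).le, rfl⟩

end AclBound

/-! ### The first-order properties that keep every degree finite. -/

/-- The language with one binary and countably many ternary relation symbols. -/
abbrev eqvTernLang : FirstOrder.Language.{0, 0} := eqvLang.sum ternLang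

/-- The binary relation symbol. -/
def eqvSymb : eqvTernLang.Relations 2 := Sum.inl EqvRel.E

/-- The ternary relation symbols. -/
def ternSymb (i : ℕ) : eqvTernLang.Relations 3 := Sum.inr (TernRel.R i)

section EqvTern

variable {N : Type w} [eqvTernLang.Structure N] {α : Type*}

/-- The interpretation of `E`. -/
def eqvRel (x y : N) : Prop :=
  Structure.RelMap (L := eqvTernLang) eqvSymb ![x, y]

/-- The binary relation on `y, z` given by the first ternary predicate with first argument `x`. -/
def ordRel (x y z : N) : Prop :=
  Structure.RelMap (L := eqvTernLang) (ternSymb 0) ![x, y, z]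

/-- The diagonal of the second ternary predicate. -/
def Marked (x : N) : Prop :=
  Structure.RelMap (L := eqvTernLang) (ternSymb 1) ![x, x, x]

/-- The formula `E(i, j)`. -/
def eqvFormula (i j : α) : eqvTernLang.Formula α :=
  Relations.formula eqvSymb ![Term.var i, Term.var j]

/-- The formula expressing `ordRel`. -/
def ordFormula (i j k : α) : eqvTernLang.Formula α :=
  Relations.formula (ternSymb 0)
    ![Term.var i, Term.var j, Term.var k]

/-- The formula expressing `Marked`. -/
def markedFormula (i : α) : eqvTernLang.Formula α :=
  Relations.formula (ternSymb 1)
    ![Term.var i, Term.var i, Term.var i]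

@[simp]
theorem realize_eqvFormula {i j : α} {v : α → N} :
    (eqvFormula i j).Realize v ↔ eqvRel (v i) (v j) := by
  rw [eqvFormula, Formula.realize_rel, eqvRel]
  refine iff_of_eq (congrArg _ (funext fun i => ?_))
  fin_cases i <;> rfl

@[simp]
theorem realize_ordFormula {i j k : α} {v : α → N} :
    (ordFormula i j k).Realize v ↔ ordRel (v i) (v j) (v k) := by
  rw [ordFormula, Formula.realize_rel, ordRel]
  refine iff_of_eq (congrArg _ (funext fun i => ?_))
  fin_cases i <;> rfl

@[simp]
theorem realize_markedFormula {i : α} {v : α → N} :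
    (markedFormula i).Realize v ↔ Marked (v i) := by
  rw [markedFormula, Formula.realize_rel, Marked]
  refine iff_of_eq (congrArg _ (funext fun i => ?_))
  fin_cases i <;> rfl

variable (N) in
/-- A structure in which `ordRel a` is a strict order, total outside the class of `a`, and even
everywhere if `a` is marked, while each class has at most one unmarked element `a`, over which the
other elements of the class are indiscernible, and no element is algebraic over `∅`. -/
structure TotalOffClasses : Prop where
  refl : ∀ a : N, eqvRel a a
  trans : ∀ a b x : N, eqvRel a x → eqvRel b x → eqvRel a b
  ord_irrefl : ∀ a x : N, ¬ ordRel a x x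
  ord_trans : ∀ a x y z : N, ordRel a x y → ordRel a y z → ordRel a x z
  ord_total : ∀ a x y : N, ¬ eqvRel a x → ¬ eqvRel a y → x ≠ y → ordRel a x y ∨ ordRel a y x
  ord_total_of_marked : ∀ a x y : N, Marked a → x ≠ y → ordRel a x y ∨ ordRel a y x
  eq_of_not_marked : ∀ a b : N, ¬ Marked a → ¬ Marked b → eqvRel a b → a = b
  indiscernible : ∀ (φ : eqvTernLang.Formula (Fin 2)) (a x y : N), ¬ Marked a → eqvRel a x →
    eqvRel a y → x ≠ a → y ≠ a → φ.Realize ![a, x] → φ.Realize ![a, y]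
  not_realize_of_finite : ∀ φ : eqvTernLang.Formula (Fin 1),
    {x : N | φ.Realize fun _ => x}.Finite → ∀ x : N, ¬ φ.Realize fun _ => x

theorem comp_pair {P : Type*} (v : α → P) (i j : α) : v ∘ ![i, j] = ![v i, v j] := by
  funext k
  fin_cases k <;> rfl

theorem TotalOffClasses.of_model_completeTheory {M : Type*} [eqvTernLang.Structure M]
    [N ⊨ eqvTernLang.completeTheory M] (h : TotalOffClasses M) : TotalOffClasses N := by
  have tr {k : ℕ} (φ : eqvTernLang.Formula (Fin k)) (hφ : ∀ v : Fin k → M, φ.Realize v) :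
      ∀ v : Fin k → N, φ.Realize v := (forall_realize_iff_of_model_completeTheory φ).2 hφ
  refine ⟨fun a => ?_, fun a b x => ?_, fun a x => ?_, fun a x y z => ?_, fun a x y => ?_,
    fun a x y => ?_, fun a b => ?_, fun φ a x y => ?_, fun φ hφ x hx => ?_⟩
  · simpa using tr (eqvFormula (0 : Fin 1) 0) (fun v : Fin _ → M => by simpa using h.refl (v 0)) ![a]
  · simpa using tr ((eqvFormula (0 : Fin 3) 2).imp ((eqvFormula 1 2).imp (eqvFormula 0 1)))
      (fun v : Fin _ → M => by simpa using h.trans (v 0) (v 1) (v 2)) ![a, b, x]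
  · simpa using tr (∼(ordFormula (0 : Fin 2) 1 1))
      (fun v : Fin _ → M => by simpa using h.ord_irrefl (v 0) (v 1)) ![a, x]
  · simpa using tr ((ordFormula (0 : Fin 4) 1 2).imp ((ordFormula 0 2 3).imp (ordFormula 0 1 3)))
      (fun v : Fin _ → M => by simpa using h.ord_trans (v 0) (v 1) (v 2) (v 3)) ![a, x, y, z]
  · simpa using tr ((∼(eqvFormula (0 : Fin 3) 1)).imp ((∼(eqvFormula 0 2)).imp
      ((∼(Term.equal (Term.var 1) (Term.var 2))).imp (ordFormula 0 1 2 ⊔ ordFormula 0 2 1))))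
      (fun v : Fin _ → M => by simpa using h.ord_total (v 0) (v 1) (v 2)) ![a, x, y]
  · simpa using tr ((markedFormula (0 : Fin 3)).imp
      ((∼(Term.equal (Term.var 1) (Term.var 2))).imp (ordFormula 0 1 2 ⊔ ordFormula 0 2 1)))
      (fun v : Fin _ → M => by simpa using h.ord_total_of_marked (v 0) (v 1) (v 2)) ![a, x, y]
  · simpa using tr ((∼(markedFormula (0 : Fin 2))).imp ((∼(markedFormula 1)).imp
      ((eqvFormula 0 1).imp (Term.equal (Term.var 0) (Term.var 1)))))
      (fun v : Fin _ → M => by simpa using h.eq_of_not_marked (v 0) (v 1)) ![a, b]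
  · simpa [comp_pair] using tr ((∼(markedFormula (0 : Fin 3))).imp ((eqvFormula 0 1).imp
      ((eqvFormula 0 2).imp ((∼(Term.equal (Term.var 1) (Term.var 0))).imp
      ((∼(Term.equal (Term.var 2) (Term.var 0))).imp
      ((φ.relabel ![0, 1]).imp (φ.relabel ![0, 2])))))))
      (fun v : Fin _ → M => by simpa [comp_pair] using h.indiscernible φ (v 0) (v 1) (v 2)) ![a, x, y]
  -- The solution set in `N` has a definite finite size, so it is finite in `M` as well, hence empty
  -- there, and emptiness transfers back.
  · have hfin := ((finite_ncard_lt_iff_of_model_completeTheory (M := M) φ _).1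
      ⟨hφ, Nat.lt_succ_self _⟩).1
    have := tr (∼φ) fun v => by
      have hv : v = fun _ => v 0 := funext fun i => by rw [Subsingleton.elim i 0]
      rw [hv]
      simpa using h.not_realize_of_finite φ hfin (v 0)
    exact (this fun _ => x) hx

variable {A : Set N}

theorem definable_ordRel {a : N} (ha : a ∈ A) :
    A.Definable eqvTernLang {v : Fin 2 → N | ordRel a (v 0) (v 1)} := by
  simpa using definable_of_formula (A := A) (α := Fin 2)
    (ordFormula (Sum.inl ()) (Sum.inr 0) (Sum.inr 1)) (fun _ : Unit => a) fun _ => ha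

theorem definable₁_eqvRel {a : N} (ha : a ∈ A) :
    A.Definable₁ eqvTernLang {x | eqvRel a x} := by
  simpa using definable₁_of_formula (A := A)
    (eqvFormula (Sum.inl ()) (Sum.inr 0)) (fun _ : Unit => a) fun _ => ha

namespace TotalOffClasses

variable (h : TotalOffClasses N)
include h

theorem mem_aclN_one {a b : N} (ha : a ∈ A) {S : Set N} (hfin : S.Finite)
    (hS : A.Definable₁ eqvTernLang S)
    (htot : ∀ x ∈ S, ∀ y ∈ S, x ≠ y → ordRel a x y ∨ ordRel a y x) (hb : b ∈ S) :
    b ∈ aclN eqvTernLang 1 A :=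
  mem_aclN_one_of_definable₁_singleton (definable₁_singleton_of_mem_of_isStrictOrder
    (definable_ordRel ha) (h.ord_irrefl a) (h.ord_trans a) hfin hS htot b hb)

theorem mem_aclN_one_of_not_eqvRel {a b : N} (ha : a ∈ A) (hb : b ∈ acl eqvTernLang A)
    (hab : ¬ eqvRel a b) : b ∈ aclN eqvTernLang 1 A := by
  obtain ⟨S, hS, hfin, hbS⟩ := hb
  exact h.mem_aclN_one ha (hfin.subset sdiff_subset)
    (Definable.sdiff hS (definable₁_eqvRel ha) : A.Definable₁ eqvTernLang (S \ {x | eqvRel a x}))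
    (fun x hx y hy => h.ord_total a x y hx.2 hy.2) ⟨hbS, hab⟩

/-- Without a marked parameter or two inequivalent ones, `A` is empty or a single unmarked point
`p`. The bound is then `1` or the size of the class of `p`, which depends on `p`. -/
theorem exists_acl_subset_aclN (A : Set N) :
    ∃ n : ℕ, 1 ≤ n ∧ acl eqvTernLang A ⊆ aclN eqvTernLang n A := by
  by_cases hmark : ∃ a ∈ A, Marked a
  · obtain ⟨a, ha, hma⟩ := hmark
    refine ⟨1, le_rfl, fun b ⟨S, hS, hfin, hb⟩ => ?_⟩
    exact h.mem_aclN_one ha hfin hS (fun x _ y _ => h.ord_total_of_marked a x y hma) hb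
  by_cases hne : ∃ a ∈ A, ∃ b ∈ A, ¬ eqvRel a b
  · obtain ⟨a, ha, b, hb, hab⟩ := hne
    refine ⟨1, le_rfl, fun c hc => ?_⟩
    by_cases hac : eqvRel a c
    · exact h.mem_aclN_one_of_not_eqvRel hb hc fun hbc => hab (h.trans _ _ _ hac hbc)
    · exact h.mem_aclN_one_of_not_eqvRel ha hc hac
  push Not at hmark hne
  have hsub : A.Subsingleton := fun a ha b hb =>
    h.eq_of_not_marked a b (hmark a ha) (hmark b hb) (hne a ha b hb)
  rcases hsub.eq_empty_or_singleton with rfl | ⟨p, rfl⟩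
  · refine ⟨1, le_rfl, fun b ⟨S, hS, hfin, hb⟩ => ?_⟩
    obtain ⟨φ, hφ⟩ := exists_formula_of_definable₁_empty hS
    exact absurd ((hφ b).1 hb)
      (h.not_realize_of_finite φ (hfin.subset fun x hx => (hφ x).2 hx) b)
  · have hp : p ∈ ({p} : Set N) := rfl
    have hpm : ¬ Marked p := hmark p hp
    by_cases hC : {x | eqvRel p x}.Finite
    · have hpos : 1 ≤ {x | eqvRel p x}.ncard := (ncard_pos hC).2 ⟨p, h.refl p⟩
      refine ⟨_, hpos, fun b hb => ?_⟩
      by_cases hpb : eqvRel p b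
      · exact ⟨_, definable₁_eqvRel hp, hC, le_rfl, hpb⟩
      · exact aclN_mono hpos (h.mem_aclN_one_of_not_eqvRel hp hb hpb)
    · refine ⟨1, le_rfl, fun b hb => ?_⟩
      by_cases hpb : eqvRel p b
      · by_cases hbp : b = p
        · exact mem_aclN_one_of_definable₁_singleton (Definable.singleton_of_mem _ hbp)
        · obtain ⟨S, hS, hfin, hbS⟩ := hb
          obtain ⟨φ, hφ⟩ := exists_formula_of_definable₁_singleton hS
          -- By indiscernibility, a formula over `p` true of `b` holds on the whole infinite class
          -- except possibly at `p`.
          refine absurd ((hfin.union (finite_singleton p)).subset fun x hx => ?_) hC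
          by_cases hxp : x = p
          · exact Or.inr hxp
          · exact Or.inl ((hφ x).2
              (h.indiscernible φ p b x hpm hpb hx hbp hxp ((hφ b).1 hbS)))
      · exact h.mem_aclN_one_of_not_eqvRel hp hb hpb

end TotalOffClasses

end EqvTern

/-! ### Affine shifts of the index group `ℤ →₀ ℤ`. -/

/-- The translation of the arguments of a finitely supported function by `k`. -/
noncomputable def shift (k : ℤ) : (ℤ →₀ ℤ) ≃+ (ℤ →₀ ℤ) := Finsupp.domCongr (Equiv.addRight k)

theorem shift_apply (k : ℤ) (y : ℤ →₀ ℤ) (i : ℤ) : shift k y i = y (i - k) := by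
  simp [shift, Finsupp.equivMapDomain_apply, sub_eq_add_neg]

theorem degree_shift (k : ℤ) (y : ℤ →₀ ℤ) : (shift k y).degree = y.degree := by
  simp only [shift, Finsupp.domCongr_apply, Finsupp.equivMapDomain_eq_mapDomain]
  exact Finsupp.degree_mapDomain _ _

/-- The least argument at which a nonzero finitely supported function does not vanish. -/
noncomputable def lead (y : ℤ →₀ ℤ) : ℤ := sInf {i | y i ≠ 0}

/-- This lets a difference of indices serve as a starting point on a cycle that turns by `k` along
with the cycle. It fails at `0`, where `lead` has the default value `0`. -/
theorem lead_shift {y : ℤ →₀ ℤ} (hy : y ≠ 0) (k : ℤ) : lead (shift k y) = lead y + k := by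
  have hne : {i | y i ≠ 0}.Nonempty := by
    by_contra h
    refine hy (Finsupp.ext fun i => ?_)
    by_contra hi
    exact h ⟨i, hi⟩
  have hb : BddBelow {i | y i ≠ 0} := Set.Finite.bddBelow y.hasFiniteSupport
  have h := (OrderIso.addRight k).map_csInf' hne hb
  simp only [OrderIso.addRight_apply] at h
  rw [lead, lead, h]
  congr 1
  ext i
  simp only [mem_ofPred_eq, shift_apply, mem_image]
  exact ⟨fun hi => ⟨i - k, hi, sub_add_cancel i k⟩, by rintro ⟨j, hj, rfl⟩; simpa using hj⟩

/-- The affine map with fixed point `u` and linear part `shift k`. -/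
noncomputable def move (u : ℤ →₀ ℤ) (k : ℤ) (w : ℤ →₀ ℤ) : ℤ →₀ ℤ := u + shift k (w - u)

variable (u : ℤ →₀ ℤ) (k : ℤ)

theorem move_self : move u k u = u := by simp [move]

theorem move_sub_move (w w' : ℤ →₀ ℤ) : move u k w - move u k w' = shift k (w - w') := by
  simp only [move, map_sub]
  abel

theorem shift_neg_shift (y : ℤ →₀ ℤ) : shift (-k) (shift k y) = y := by
  ext i
  simp [shift_apply]

theorem move_neg_move (w : ℤ →₀ ℤ) : move u (-k) (move u k w) = w := by
  simp [move, shift_neg_shift]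

theorem degree_move (w : ℤ →₀ ℤ) : (move u k w).degree = w.degree := by
  simp [move, degree_shift]

theorem move_injective : Function.Injective (move u k) :=
  Function.LeftInverse.injective (move_neg_move u k)

/-- The first index at which the two functions differ is translated by `k`, and the values compared
there change by a common amount. -/
theorem toLex_move_lt {w w' : ℤ →₀ ℤ} (h : toLex w < toLex w') :
    toLex (move u k w) < toLex (move u k w') := by
  obtain ⟨i, hi, hlt⟩ := Finsupp.Lex.lt_iff.1 h
  refine Finsupp.Lex.lt_iff.2 ⟨i + k, fun j hj => ?_, ?_⟩
  · have := hi (j - k) (by omega)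
    simpa [move, shift_apply] using this
  · simpa [move, shift_apply] using hlt

theorem toLex_move_lt_iff {w w' : ℤ →₀ ℤ} :
    toLex (move u k w) < toLex (move u k w') ↔ toLex w < toLex w' := by
  refine ⟨fun h => ?_, toLex_move_lt u k⟩
  simpa only [move_neg_move] using toLex_move_lt u (-k) h

theorem move_left_injective {u w : ℤ →₀ ℤ} (h : w ≠ u) : Function.Injective fun k => move u k w := by
  intro k l hkl
  have h1 := congrArg lead (add_left_cancel hkl)
  rw [lead_shift (sub_ne_zero.2 h), lead_shift (sub_ne_zero.2 h)] at h1
  exact add_left_cancel h1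

/-! ### The structure of cycles, of degree `ω`. -/

/-- The points of the structure: a class for each `v : ℤ →₀ ℤ`, consisting of an unmarked point
`none` and of a cycle whose length is the sum of the values of `v`. -/
abbrev CyclePoint : Type := {x : (ℤ →₀ ℤ) × Option ℤ // ∀ j ∈ x.2, 0 ≤ j ∧ j < x.1.degree}

namespace CyclePoint

/-- The point of the cycle of `x`, or the integer, at which `a` starts counting. -/
noncomputable def offset (a x : CyclePoint) : ℤ :=
  open Classical in if x.1.1 = a.1.1 then a.1.2.getD 0 else lead (x.1.1 - a.1.1)

/-- The position of `x` in its class from the point of view of `a`. -/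
noncomputable def key (a x : CyclePoint) : ℤ :=
  x.1.2.elim (-1) fun j => (j - offset a x) % x.1.1.degree

/-- The strict order on points determined by `a`; it is trivial on the class of `a` if `a` is
unmarked. -/
def Prec (a x y : CyclePoint) : Prop :=
  toLex x.1.1 < toLex y.1.1 ∨
    (x.1.1 = y.1.1 ∧ (x.1.1 = a.1.1 → a.1.2 ≠ none) ∧ key a x < key a y)

theorem offset_congr {a x y : CyclePoint} (h : x.1.1 = y.1.1) : offset a x = offset a y := by
  simp only [offset, h]

/-- The unmarked point has key `-1`, below all residues, and positions in `[0, degree)` are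
determined by their residues. -/
theorem ext_key {a x y : CyclePoint} (h : x.1.1 = y.1.1) (hk : key a x = key a y) : x = y := by
  have ho := offset_congr (a := a) h
  obtain ⟨⟨w, o⟩, hx⟩ := x
  obtain ⟨⟨w', o'⟩, hy⟩ := y
  obtain rfl : w = w' := h
  have hpos {j : ℤ} (c : ℤ) (hj : 0 ≤ j ∧ j < w.degree) : 0 ≤ (j - c) % w.degree :=
    Int.emod_nonneg _ (by omega)
  simp only [key, ho] at hk
  rcases o with _ | j <;> rcases o' with _ | j' <;> simp only [Option.elim] at hk
  · rfl
  · have := hpos (offset a ⟨(w, some j'), hy⟩) (hy j' rfl)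
    omega
  · have := hpos (offset a ⟨(w, none), hy⟩) (hx j rfl)
    omega
  · have h1 : j ≡ j' [ZMOD w.degree] := by
      have h2 : j - _ ≡ j' - _ [ZMOD w.degree] := hk
      simpa using h2.add_right (offset a ⟨(w, some j'), hy⟩)
    have hj := hx j rfl
    have hj' := hy j' rfl
    have : j = j' := by rwa [Int.ModEq, Int.emod_eq_of_lt hj.1 hj.2, Int.emod_eq_of_lt hj'.1 hj'.2] at h1
    subst this
    rfl

theorem prec_irrefl (a x : CyclePoint) : ¬ Prec a x x := by
  rintro (h | ⟨-, -, h⟩) <;> exact lt_irrefl _ h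

theorem prec_trans {a x y z : CyclePoint} (h : Prec a x y) (h' : Prec a y z) : Prec a x z := by
  rcases h with h | ⟨h1, h2, h3⟩ <;> rcases h' with h' | ⟨h1', h2', h3'⟩
  · exact Or.inl (h.trans h')
  · exact Or.inl (h1' ▸ h)
  · exact Or.inl (h1 ▸ h')
  · exact Or.inr ⟨h1.trans h1', h2, h3.trans h3'⟩

theorem prec_total {a x y : CyclePoint} (h : x.1.1 = a.1.1 → y.1.1 = a.1.1 → a.1.2 ≠ none)
    (hxy : x ≠ y) : Prec a x y ∨ Prec a y x := by
  rcases lt_trichotomy (toLex x.1.1) (toLex y.1.1) with hlt | heq | hgt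
  · exact Or.inl (Or.inl hlt)
  · have heq' : x.1.1 = y.1.1 := toLex.injective heq
    rcases lt_or_gt_of_ne fun hk => hxy (ext_key (a := a) heq' hk) with hlt | hgt
    · exact Or.inl (Or.inr ⟨heq', fun hx => h hx (heq' ▸ hx), hlt⟩)
    · exact Or.inr (Or.inr ⟨heq'.symm, fun hy => h (heq'.trans hy) hy, hgt⟩)
  · exact Or.inr (Or.inl hgt)

/-- The map induced by `move u k` that rotates each cycle by `k`. -/
noncomputable def rotate (x : CyclePoint) : CyclePoint :=
  ⟨(move u k x.1.1, x.1.2.map fun j => (j + k) % x.1.1.degree), by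
    intro j hj
    obtain ⟨i, hi, rfl⟩ := Option.mem_map.1 hj
    have := x.2 i hi
    rw [degree_move]
    exact ⟨Int.emod_nonneg _ (by omega), Int.emod_lt_of_pos _ (by omega)⟩⟩

theorem rotate_neg_rotate (x : CyclePoint) : rotate u (-k) (rotate u k x) = x := by
  obtain ⟨⟨w, o⟩, hx⟩ := x
  refine Subtype.ext (Prod.ext (move_neg_move u k w) ?_)
  rcases o with _ | j
  · rfl
  · have hj := hx j rfl
    simp only [rotate, Option.map_some, degree_move, Int.emod_add_emod, Option.some.injEq]
    rw [add_neg_cancel_right, Int.emod_eq_of_lt hj.1 hj.2]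

/-- `rotate` as a permutation. -/
noncomputable def rotateEquiv : CyclePoint ≃ CyclePoint where
  toFun := rotate u k
  invFun := rotate u (-k)
  left_inv := rotate_neg_rotate u k
  right_inv x := by simpa using rotate_neg_rotate u (-k) x

/-- Position and offset both grow by `k` modulo the length of the cycle. The hypothesis excludes the
default offset `0` of an unmarked `a` in its own class, which does not turn; this is why `Prec` is
trivial there. -/
theorem key_rotate {a x : CyclePoint} (h : x.1.1 = a.1.1 → a.1.2 ≠ none) :
    key (rotate u k a) (rotate u k x) = key a x := by
  obtain ⟨⟨w, o⟩, hx⟩ := x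
  rcases o with _ | j
  · rfl
  have ho : offset (rotate u k a) (rotate u k ⟨(w, some j), hx⟩) ≡
      offset a ⟨(w, some j), hx⟩ + k [ZMOD w.degree] := by
    by_cases hw : w = a.1.1
    · obtain ⟨⟨v, o⟩, ha⟩ := a
      obtain rfl : w = v := hw
      rcases o with _ | i
      · exact absurd rfl (h rfl)
      simpa [offset, rotate] using Int.mod_modEq _ _
    · have hw' : move u k w ≠ move u k a.1.1 := fun h => hw (move_injective u k h)
      simp only [offset, rotate, hw, hw', if_false, move_sub_move,
        lead_shift (sub_ne_zero.2 hw)]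
      exact Int.ModEq.rfl
  have hj : (j + k) % w.degree ≡ j + k [ZMOD w.degree] := Int.mod_modEq _ _
  have := hj.sub ho
  rw [add_sub_add_right_eq_sub] at this
  simp only [key, Option.elim]
  simp only [rotate, degree_move, Option.map_some] at this ⊢
  exact this

theorem prec_rotate {a x y : CyclePoint} :
    Prec (rotate u k a) (rotate u k x) (rotate u k y) ↔ Prec a x y := by
  have hn : (rotate u k a).1.2 = none ↔ a.1.2 = none := Option.map_eq_none_iff
  have hm (z z' : CyclePoint) : (rotate u k z).1.1 = (rotate u k z').1.1 ↔ z.1.1 = z'.1.1 :=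
    (move_injective u k).eq_iff
  refine or_congr (toLex_move_lt_iff u k) ?_
  rw [hm, hm, Ne, hn]
  refine and_congr_right fun hxy => and_congr_right fun h => ?_
  rw [key_rotate u k h, key_rotate u k fun hy => h (hxy.trans hy)]

instance : eqvLang.Structure CyclePoint := eqvStructure (Setoid.ker fun x => x.1.1)

/-- Two predicates suffice: the first carries the orders, and all later ones repeat the marking. -/
instance : ternLang.Structure CyclePoint where
  funMap := fun f => f.elim
  RelMap := fun {_} r => match r with
    | TernRel.R 0 => fun v => Prec (v 0) (v 1) (v 2)
    | TernRel.R (_ + 1) => fun v => (v 0).1.2 ≠ none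

theorem eqvRel_iff {x y : CyclePoint} : eqvRel x y ↔ x.1.1 = y.1.1 := Iff.rfl

/-- `rotate` as an automorphism. -/
noncomputable def rotateAut : CyclePoint ≃[eqvTernLang] CyclePoint where
  toEquiv := rotateEquiv u k
  map_fun' := fun f => f.elim (fun f => f.elim) fun f => f.elim
  map_rel' := by
    rintro _ (⟨⟨⟩⟩ | ⟨⟨_ | i⟩⟩) v
    · exact (move_injective u k).eq_iff
    · exact prec_rotate u k
    · exact not_congr Option.map_eq_none_iff

theorem totalOffClasses : TotalOffClasses CyclePoint where
  refl _ := rfl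
  trans a b x h h' := (h : a.1.1 = x.1.1).trans (h' : b.1.1 = x.1.1).symm
  ord_irrefl := prec_irrefl
  ord_trans _ _ _ _ := prec_trans
  ord_total a x y hx _ hxy := prec_total (fun h => absurd (eqvRel_iff.2 h.symm) hx) hxy
  ord_total_of_marked a x y ha hxy := prec_total (fun _ _ => ha) hxy
  eq_of_not_marked a b ha hb hab :=
    Subtype.ext (Prod.ext hab ((not_not.1 ha).trans (not_not.1 hb).symm))
  indiscernible φ a x y ha hax hay hxa hya hφ := by
    obtain ⟨⟨v, oa⟩, ha'⟩ := a
    obtain ⟨⟨w, ox⟩, hx⟩ := x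
    obtain ⟨⟨w', oy⟩, hy⟩ := y
    obtain rfl : v = w := hax
    obtain rfl : v = w' := hay
    obtain rfl : oa = none := not_not.1 ha
    rcases ox with _ | i
    · exact absurd rfl hxa
    rcases oy with _ | j
    · exact absurd rfl hya
    have hj := hy j rfl
    -- The rotation about `v` itself keeps the class and its unmarked point, and turns position `i`
    -- into `j`.
    have hv : rotateAut v (j - i) ∘ ![⟨(v, none), ha'⟩, ⟨(v, some i), hx⟩] =
        ![⟨(v, none), ha'⟩, ⟨(v, some j), hy⟩] := by
      funext l
      fin_cases l
      · exact Subtype.ext (Prod.ext (move_self v _) rfl)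
      · refine Subtype.ext (Prod.ext (move_self v _) (congrArg some ?_))
        exact (congrArg (· % v.degree) (add_sub_cancel i j)).trans (Int.emod_eq_of_lt hj.1 hj.2)
    rw [← hv]
    exact (StrongHomClass.realize_formula (rotateAut v (j - i)) φ).2 hφ
  not_realize_of_finite φ hfin x hx := by
    -- Rotations about another index `w` send `x` into infinitely many classes.
    obtain ⟨w, hw⟩ := exists_ne x.1.1
    refine infinite_of_injective_forall_mem (f := fun k : ℤ => rotate w k x) (fun k l hkl => ?_)
      (fun k => ?_) hfin
    · exact move_left_injective hw.symm (congrArg (fun z => z.1.1) hkl)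
    · have := (StrongHomClass.realize_formula (rotateAut w k) φ).2 hx
      exact this

/-- The unmarked point of a class. -/
def center (v : ℤ →₀ ℤ) : CyclePoint := ⟨(v, none), by simp⟩

theorem finite_class (v : ℤ →₀ ℤ) : {b : CyclePoint | v = b.1.1}.Finite ∧
    {b : CyclePoint | v = b.1.1}.ncard = v.degree.toNat + 1 := by
  have hinj : InjOn (fun b : CyclePoint => b.1.2) {b : CyclePoint | v = b.1.1} :=
    fun a ha b hb h => Subtype.ext (Prod.ext ((ha : v = _).symm.trans hb) h)
  have himg : (fun b : CyclePoint => b.1.2) '' {b : CyclePoint | v = b.1.1} =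
      ↑(Finset.insertNone (Finset.Ico 0 v.degree)) := by
    ext o
    simp only [mem_image, mem_ofPred_eq, Finset.mem_coe, Finset.mem_insertNone, Finset.mem_Ico]
    constructor
    · rintro ⟨b, rfl, rfl⟩
      exact b.2
    · exact fun h => ⟨⟨(v, o), h⟩, rfl, rfl⟩
  constructor
  · exact Finite.of_finite_image (himg ▸ Finset.finite_toSet _) hinj
  · rw [← hinj.ncard_image, himg, ncard_coe_finset, Finset.card_insertNone,
      Int.card_Ico, sub_zero]

theorem infManyClassesOfEachFiniteSize : InfManyClassesOfEachFiniteSize CyclePoint := by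
  refine ⟨fun a => (finite_class a.1.1).1, fun n hn => ?_⟩
  -- The degree is `n - 1`, leaving room for the unmarked point, and `k` tells the classes apart.
  let c (k : ℤ) : ℤ →₀ ℤ := Finsupp.single k 1 + Finsupp.single 0 ((n : ℤ) - 2)
  refine infinite_of_injective_forall_mem
    (f := fun k : ℤ => {b : CyclePoint | interpE CyclePoint (center (c k)) b}) (fun k l hkl => ?_)
    fun k => ⟨⟨_, rfl⟩, ?_⟩
  · have h : center (c k) ∈ {b : CyclePoint | interpE CyclePoint (center (c l)) b} :=
      (Set.ext_iff.1 hkl _).1 (rfl : c k = c k)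
    have h' : c l = c k := h
    exact (Finsupp.single_left_injective one_ne_zero (add_right_cancel h')).symm
  · refine (finite_class (c k)).2.trans ?_
    simp only [c, map_add, Finsupp.degree_single]
    omega

theorem natCast_le_degAclSet (n : ℕ) : ((n : Ordinal.{0}) : WithTop Ordinal.{0}) ≤
    degAclSet eqvTernLang {center (Finsupp.single 0 ((n : ℤ) + 1))} := by
  -- Length `n + 1` rather than `n` keeps the cycle nonempty when `n = 0`.
  set p := center (Finsupp.single 0 ((n : ℤ) + 1))
  have hdeg : p.1.1.degree = n + 1 := Finsupp.degree_single _ _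
  obtain ⟨hfin, hcard⟩ := finite_class p.1.1
  have hb : ∀ j ∈ some (0 : ℤ), 0 ≤ j ∧ j < p.1.1.degree := by
    rintro j ⟨⟩
    omega
  let b : CyclePoint := ⟨(p.1.1, some 0), hb⟩
  refine le_degAclSet (b := b) ⟨_, definable₁_eqvRel (mem_singleton p), hfin, rfl⟩
    fun S hS hSfin hbS => ?_
  obtain ⟨φ, hφ⟩ := exists_formula_of_definable₁_singleton hS
  have hsub : {x : CyclePoint | p.1.1 = x.1.1} \ {p} ⊆ S := fun x hx => (hφ x).2
    (totalOffClasses.indiscernible φ p b x (fun h => h rfl) rfl hx.1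
      (fun h => by simpa [b, p, center] using congrArg (fun z => z.1.2) h) hx.2 ((hφ b).1 hbS))
  have h1 := ncard_le_ncard hsub hSfin
  rw [ncard_sdiff_singleton_of_mem (show p ∈ {x : CyclePoint | p.1.1 = x.1.1} from rfl), hcard,
    hdeg] at h1
  omega

instance : Nonempty CyclePoint := ⟨center 0⟩

theorem degAcl_completeTheory : degAcl (eqvTernLang.completeTheory CyclePoint) =
    ((Ordinal.omega0 : Ordinal.{0}) : WithTop Ordinal.{0}) := by
  refine le_antisymm (degAcl_le_omega0 fun N A => ?_) (omega0_le_of_natCast_le fun n => ?_)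
  · exact (totalOffClasses.of_model_completeTheory (N := N)).exists_acl_subset_aclN A
  · exact (natCast_le_degAclSet n).trans
      (degAclSet_le_degAcl _ (Theory.ModelType.of _ CyclePoint) _)

end CyclePoint

end Algebraization

/-! ### The main theorem. -/

theorem mainTheorem1 :
    -- the values of the degree of algebraization
    (∀ (L : FirstOrder.Language.{u, v}) (T : L.Theory), T.IsSatisfiable → degAcl T ∈ degValues) ∧
    -- every such value is attained by a complete theory
    (∀ d ∈ degValues, ∃ (L : FirstOrder.Language.{0, 0}) (T : L.Theory), T.IsComplete ∧ degAcl T = d) ∧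
    -- finite values and `∞`: theories of an equivalence relation
    (∀ d ∈ degValues, d ≠ ((Ordinal.omega0 : Ordinal.{0}) : WithTop Ordinal.{0}) →
      ∃ (M : Type) (_ : Nonempty M) (_ : eqvLang.Structure M),
        Equivalence (interpE M) ∧ degAcl (eqvLang.completeTheory M) = d) ∧
    -- the value `ω`: an expansion of an equivalence relation by countably many ternary predicates
    (∃ (M : Type) (_ : Nonempty M) (_ : eqvLang.Structure M) (_ : ternLang.Structure M),
      Equivalence (interpE M) ∧ InfManyClassesOfEachFiniteSize M ∧
        degAcl ((eqvLang.sum ternLang).completeTheory M) =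
          ((Ordinal.omega0 : Ordinal.{0}) : WithTop Ordinal.{0})) := by
  have hE : ∀ d ∈ degValues, d ≠ ((Ordinal.omega0 : Ordinal.{0}) : WithTop Ordinal.{0}) →
      ∃ (M : Type) (_ : Nonempty M) (_ : eqvLang.Structure M),
        Equivalence (interpE M) ∧ degAcl (eqvLang.completeTheory M) = d := by
    intro d hd hne
    rcases mem_degValues_cases hd with ⟨n, hn, rfl⟩ | rfl | rfl
    · exact exists_degAcl_eq_natCast n hn
    · exact absurd rfl hne
    · exact exists_degAcl_eq_top
  refine ⟨fun L T hT => degAcl_mem_degValues hT, fun d hd => ?_, hE, CyclePoint, inferInstance,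
    inferInstance, inferInstance, (Setoid.ker fun x : CyclePoint => x.1.1).iseqv,
    CyclePoint.infManyClassesOfEachFiniteSize, CyclePoint.degAcl_completeTheory⟩
  by_cases hω : d = ((Ordinal.omega0 : Ordinal.{0}) : WithTop Ordinal.{0})
  · exact ⟨_, _, FirstOrder.Language.completeTheory.isComplete _ CyclePoint,
      CyclePoint.degAcl_completeTheory.trans hω.symm⟩
  · obtain ⟨M, _, _, -, hM⟩ := hE d hd hω
    exact ⟨_, _, FirstOrder.Language.completeTheory.isComplete _ M, hM⟩
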